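/- Let $s>0$ and let $\mathcal P=\mathbb R[S_1,S_2,S_3]/(S_1^2+S_2^2+S_3^2-s^2)$ be the Poisson algebra of polynomials on the sphere of radius $s$, with the bracket \[\{f,g\}=\sum_{i,j,k=1}^3\epsilon_{ijk}\,S_i\,\frac{\partial f}{\partial S_j}\,\frac{\partial g}{\partial S_k}\] computed on polynomial representatives. The degree of an element of $\mathcal P$ is the minimum of the degrees of its polynomial representatives. By a Poisson subalgebra of $\mathcal P$ we mean a real linear subspace closed under $\{\cdot,\cdot\}$ (not necessarily under multiplication). Let $\mathcal P^1$ be the Poisson subalgebra of elements of degree at most $1$, let $\mathcal O$ be the Poisson subalgebra of odd polynomials (classes of polynomials all of whose terms have odd degree), and let $\tilde{\mathcal O}=\mathcal O\oplus\mathbb R$ be the Poisson subalgebra obtained by adding the constants. Then $\mathcal P^1$ is a maximal Poisson subalgebra of $\tilde{\mathcal O}$: one has $\mathcal P^1\subsetneq\tilde{\mathcal O}$, and every Poisson subalgebra $\mathcal R$ with $\mathcal P^1\subseteq\mathcal R\subseteq\tilde{\mathcal O}$ equals $\mathcal P^1$ or $\tilde{\mathcal O}$. Moreover, for every $r\in\mathcal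 O$ of degree greater than $1$, the smallest Poisson subalgebra of $\mathcal P$ containing $\mathcal P^1$ and $r$ is $\tilde{\mathcal O}$. -/

import Mathlib

namespace SpinSphere

open MvPolynomial

noncomputable section

/-! ### The bracket on polynomials in three variables -/

/-- The bracket `{f, g} = ∑ ε_{ijk} S_i (∂f/∂S_j) (∂g/∂S_k)` on `ℝ[S₁, S₂, S₃]`, with the sum over
the six nonzero `ε_{ijk}` written out; the variables are indexed by `0, 1, 2`. -/
def polyBracket (f g : MvPolynomial (Fin 3) ℝ) : MvPolynomial (Fin 3) ℝ :=
  X 0 * (pderiv 1 f * pderiv 2 g - pderiv 2 f * pderiv 1 g) +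
  X 1 * (pderiv 2 f * pderiv 0 g - pderiv 0 f * pderiv 2 g) +
  X 2 * (pderiv 0 f * pderiv 1 g - pderiv 1 f * pderiv 0 g)

theorem pderiv_pderiv_comm (i j : Fin 3) (f : MvPolynomial (Fin 3) ℝ) :
    pderiv i (pderiv j f) = pderiv j (pderiv i f) := by
  let D : Fin 3 → Derivation ℝ (MvPolynomial (Fin 3) ℝ) (MvPolynomial (Fin 3) ℝ) := pderiv
  have h : ⁅D i, D j⁆ = 0 := by
    apply MvPolynomial.derivation_ext
    intro k
    rw [Derivation.commutator_apply]
    simp only [D, pderiv_X, Pi.single_apply]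
    split_ifs <;> simp
  have h2 : ⁅D i, D j⁆ f = 0 := by rw [h]; rfl
  rw [Derivation.commutator_apply] at h2
  exact sub_eq_zero.mp h2

theorem polyBracket_add_left (f g h : MvPolynomial (Fin 3) ℝ) :
    polyBracket (f + g) h = polyBracket f h + polyBracket g h := by
  simp only [polyBracket, map_add]; ring

theorem polyBracket_antisymm (f g : MvPolynomial (Fin 3) ℝ) :
    polyBracket f g = - polyBracket g f := by
  simp only [polyBracket]; ring

theorem polyBracket_add_right (f g h : MvPolynomial (Fin 3) ℝ) :
    polyBracket f (g + h) = polyBracket f g + polyBracket f h := by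
  simp only [polyBracket, map_add]; ring

theorem polyBracket_smul_right (c : ℝ) (f g : MvPolynomial (Fin 3) ℝ) :
    polyBracket f (c • g) = c • polyBracket f g := by
  simp only [polyBracket, smul_eq_C_mul, pderiv_C_mul]; ring

theorem polyBracket_jacobi (f g h : MvPolynomial (Fin 3) ℝ) :
    polyBracket f (polyBracket g h) =
      polyBracket (polyBracket f g) h + polyBracket g (polyBracket f h) := by
  have e10 := pderiv_pderiv_comm 1 0
  have e20 := pderiv_pderiv_comm 2 0
  have e21 := pderiv_pderiv_comm 2 1
  simp [polyBracket, pderiv_X, e10, e20, e21]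
  ring

/-! ### The Poisson algebra of polynomials on the sphere -/

/-- The ideal of `ℝ[S₁, S₂, S₃]` generated by `S₁² + S₂² + S₃² - s²`. -/
def sphereIdeal (s : ℝ) : Ideal (MvPolynomial (Fin 3) ℝ) :=
  Ideal.span {X 0 ^ 2 + X 1 ^ 2 + X 2 ^ 2 - C (s ^ 2)}

/-- The algebra `𝒫` of polynomials in `S₁, S₂, S₃` modulo the relation `S₁² + S₂² + S₃² = s²`. -/
def Poly (s : ℝ) : Type := MvPolynomial (Fin 3) ℝ ⧸ sphereIdeal s

instance (s : ℝ) : CommRing (Poly s) := inferInstanceAs (CommRing (_ ⧸ sphereIdeal s))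

instance (s : ℝ) : Algebra ℝ (Poly s) := inferInstanceAs (Algebra ℝ (_ ⧸ sphereIdeal s))

/-- The class in `𝒫` of a polynomial in `S₁, S₂, S₃`. -/
def mk (s : ℝ) : MvPolynomial (Fin 3) ℝ →ₐ[ℝ] Poly s := Ideal.Quotient.mkₐ ℝ (sphereIdeal s)

theorem mk_surjective (s : ℝ) : Function.Surjective (mk s) :=
  Ideal.Quotient.mkₐ_surjective ℝ (sphereIdeal s)

theorem mk_eq_mk_iff {s : ℝ} {f g : MvPolynomial (Fin 3) ℝ} :
    mk s f = mk s g ↔ f - g ∈ sphereIdeal s :=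
  Ideal.Quotient.eq

theorem polyBracket_mem_sphereIdeal {s : ℝ} (f : MvPolynomial (Fin 3) ℝ)
    {g : MvPolynomial (Fin 3) ℝ} (hg : g ∈ sphereIdeal s) :
    polyBracket f g ∈ sphereIdeal s := by
  obtain ⟨a, rfl⟩ := Ideal.mem_span_singleton'.mp hg
  have : polyBracket f (a * (X 0 ^ 2 + X 1 ^ 2 + X 2 ^ 2 - C (s ^ 2))) =
      polyBracket f a * (X 0 ^ 2 + X 1 ^ 2 + X 2 ^ 2 - C (s ^ 2)) := by
    simp [polyBracket, pow_two, pderiv_X]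
    ring
  rw [this]
  exact Ideal.mul_mem_left _ _ (Ideal.subset_span rfl)

theorem mk_polyBracket_congr {s : ℝ} {f f' g g' : MvPolynomial (Fin 3) ℝ}
    (hf : mk s f = mk s f') (hg : mk s g = mk s g') :
    mk s (polyBracket f g) = mk s (polyBracket f' g') := by
  have h1 : mk s (polyBracket f g) = mk s (polyBracket f g') := by
    rw [mk_eq_mk_iff] at hg ⊢
    have := polyBracket_mem_sphereIdeal f hg
    rwa [sub_eq_add_neg, polyBracket_add_right, ← neg_one_smul ℝ g', polyBracket_smul_right,
      neg_one_smul, ← sub_eq_add_neg] at this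
  have h2 : mk s (polyBracket g' f) = mk s (polyBracket g' f') := by
    rw [mk_eq_mk_iff] at hf ⊢
    have := polyBracket_mem_sphereIdeal g' hf
    rwa [sub_eq_add_neg, polyBracket_add_right, ← neg_one_smul ℝ f', polyBracket_smul_right,
      neg_one_smul, ← sub_eq_add_neg] at this
  rw [h1, polyBracket_antisymm f, polyBracket_antisymm f', map_neg, map_neg, h2]

/-- The Poisson bracket of `𝒫`, computed on polynomial representatives. -/
instance (s : ℝ) : Bracket (Poly s) (Poly s) where
  bracket p q := Quotient.liftOn₂ p q (fun f g => mk s (polyBracket f g))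
    (fun _ _ _ _ hf hg =>
      mk_polyBracket_congr (Quotient.sound hf : mk s _ = mk s _) (Quotient.sound hg))

theorem mk_lie_mk (s : ℝ) (f g : MvPolynomial (Fin 3) ℝ) :
    ⁅mk s f, mk s g⁆ = mk s (polyBracket f g) := rfl

instance (s : ℝ) : LieRing (Poly s) where
  add_lie p q r := by
    obtain ⟨f, rfl⟩ := mk_surjective s p
    obtain ⟨g, rfl⟩ := mk_surjective s q
    obtain ⟨h, rfl⟩ := mk_surjective s r
    rw [← map_add, mk_lie_mk, mk_lie_mk, mk_lie_mk, polyBracket_add_left, map_add]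
  lie_add p q r := by
    obtain ⟨f, rfl⟩ := mk_surjective s p
    obtain ⟨g, rfl⟩ := mk_surjective s q
    obtain ⟨h, rfl⟩ := mk_surjective s r
    rw [← map_add, mk_lie_mk, mk_lie_mk, mk_lie_mk, polyBracket_add_right, map_add]
  lie_self p := by
    obtain ⟨f, rfl⟩ := mk_surjective s p
    have : polyBracket f f = 0 := by simp only [polyBracket]; ring
    rw [mk_lie_mk, this, map_zero]
  leibniz_lie p q r := by
    obtain ⟨f, rfl⟩ := mk_surjective s p
    obtain ⟨g, rfl⟩ := mk_surjective s q
    obtain ⟨h, rfl⟩ := mk_surjective s r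
    simp only [mk_lie_mk]
    rw [← map_add, polyBracket_jacobi]

instance (s : ℝ) : LieAlgebra ℝ (Poly s) where
  lie_smul c p q := by
    obtain ⟨f, rfl⟩ := mk_surjective s p
    obtain ⟨g, rfl⟩ := mk_surjective s q
    rw [← map_smul, mk_lie_mk, mk_lie_mk, polyBracket_smul_right, map_smul]

/-- The degree of an element of `𝒫`: the minimum of the degrees of its representatives. -/
def degree {s : ℝ} (p : Poly s) : ℕ :=
  sInf {n | ∃ f : MvPolynomial (Fin 3) ℝ, mk s f = p ∧ f.totalDegree = n}

/-! ### The subalgebras -/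

theorem polyBracket_mem_restrictSupport {A B U : Set (Fin 3 →₀ ℕ)}
    (h : ∀ (a b : Fin 3 →₀ ℕ) (i j k : Fin 3), a + Finsupp.single j 1 ∈ A →
      b + Finsupp.single k 1 ∈ B → Finsupp.single i 1 + (a + b) ∈ U)
    {f g : MvPolynomial (Fin 3) ℝ} (hf : f ∈ restrictSupport ℝ A)
    (hg : g ∈ restrictSupport ℝ B) : polyBracket f g ∈ restrictSupport ℝ U := by
  have hd : ∀ (D : Set (Fin 3 →₀ ℕ)) (q : MvPolynomial (Fin 3) ℝ) (j : Fin 3),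
      q ∈ restrictSupport ℝ D →
        pderiv j q ∈ restrictSupport ℝ {a | a + Finsupp.single j 1 ∈ D} := by
    intro D q j hq
    rw [mem_restrictSupport_iff] at hq ⊢
    intro m hm
    apply hq
    simp only [Finset.mem_coe, mem_support_iff, coeff_pderiv] at hm ⊢
    exact left_ne_zero_of_mul hm
  have key : ∀ i j k : Fin 3, X i * (pderiv j f * pderiv k g) ∈ restrictSupport ℝ U := by
    intro i j k
    have hX : (X i : MvPolynomial (Fin 3) ℝ) ∈ restrictSupport ℝ {Finsupp.single i 1} := by
      simp [X]
    have := Submodule.mul_mem_mul hX (Submodule.mul_mem_mul (hd A f j hf) (hd B g k hg))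
    rw [← restrictSupport_add, ← restrictSupport_add] at this
    refine restrictSupport_mono (R := ℝ) ?_ this
    intro m hm
    obtain ⟨x, hx, y, hy, rfl⟩ := Set.mem_add.mp hm
    obtain ⟨a, ha, b, hb, rfl⟩ := Set.mem_add.mp hy
    rw [Set.mem_singleton_iff.mp hx]
    exact h a b i j k ha hb
  simp only [polyBracket, mul_sub]
  exact add_mem (add_mem (sub_mem (key _ _ _) (key _ _ _)) (sub_mem (key _ _ _) (key _ _ _)))
    (sub_mem (key _ _ _) (key _ _ _))

/-- The subspace `𝒫ᵏ` of elements of degree at most `k`. -/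
def polyLE (s : ℝ) (k : ℕ) : Submodule ℝ (Poly s) :=
  (restrictTotalDegree (Fin 3) ℝ k).map (mk s).toLinearMap

theorem mem_polyLE_iff {s : ℝ} {k : ℕ} {p : Poly s} : p ∈ polyLE s k ↔ degree p ≤ k := by
  constructor
  · rintro ⟨f, hf, rfl⟩
    have h : degree (mk s f) ≤ f.totalDegree := Nat.sInf_le ⟨f, rfl, rfl⟩
    exact h.trans ((mem_restrictTotalDegree _ _ _).mp hf)
  · intro h
    have hne : {n | ∃ f : MvPolynomial (Fin 3) ℝ, mk s f = p ∧ f.totalDegree = n}.Nonempty := by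
      obtain ⟨f, hf⟩ := mk_surjective s p
      exact ⟨_, f, hf, rfl⟩
    obtain ⟨f, hf, hd⟩ := Nat.sInf_mem hne
    exact ⟨f, (mem_restrictTotalDegree _ _ _).mpr (hd.trans_le h), hf⟩

/-- The Poisson subalgebra `𝒫¹` of elements of degree at most one. -/
def polyOne (s : ℝ) : LieSubalgebra ℝ (Poly s) where
  toSubmodule := polyLE s 1
  lie_mem' := by
    rintro _ _ ⟨f, hf, rfl⟩ ⟨g, hg, rfl⟩
    refine ⟨polyBracket f g, polyBracket_mem_restrictSupport ?_ hf hg, rfl⟩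
    intro a b i j k ha hb
    change (a + Finsupp.single j 1).degree ≤ 1 at ha
    change (b + Finsupp.single k 1).degree ≤ 1 at hb
    change (Finsupp.single i 1 + (a + b)).degree ≤ 1
    simp only [map_add, Finsupp.degree_single] at ha hb ⊢
    omega

/-- The Poisson subalgebra `𝒪` of odd polynomials: the classes of the polynomials all of whose
terms are of odd degree. -/
def odd (s : ℝ) : LieSubalgebra ℝ (Poly s) where
  toSubmodule := (restrictSupport ℝ {m : Fin 3 →₀ ℕ | Odd m.degree}).map (mk s).toLinearMap
  lie_mem' := by
    rintro _ _ ⟨f, hf, rfl⟩ ⟨g, hg, rfl⟩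
    refine ⟨polyBracket f g, polyBracket_mem_restrictSupport ?_ hf hg, rfl⟩
    intro a b i j k ha hb
    simp only [Set.mem_ofPred_eq, map_add, Finsupp.degree_single, Nat.odd_iff] at ha hb ⊢
    omega

theorem lie_one (s : ℝ) (p : Poly s) : ⁅p, (1 : Poly s)⁆ = 0 := by
  obtain ⟨f, rfl⟩ := mk_surjective s p
  rw [← map_one (mk s), mk_lie_mk]
  simp [polyBracket]

/-- The Poisson subalgebra `𝒪 ⊕ ℝ`: odd polynomials plus constants. -/
def oddTilde (s : ℝ) : LieSubalgebra ℝ (Poly s) where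
  toSubmodule := (odd s).toSubmodule ⊔ Submodule.span ℝ {1}
  lie_mem' := by
    intro p q hp hq
    obtain ⟨a, ha, u, hu, rfl⟩ := Submodule.mem_sup.mp hp
    obtain ⟨b, hb, v, hv, rfl⟩ := Submodule.mem_sup.mp hq
    obtain ⟨c, rfl⟩ := Submodule.mem_span_singleton.mp hu
    obtain ⟨d, rfl⟩ := Submodule.mem_span_singleton.mp hv
    have h1 : ∀ x : Poly s, ⁅(1 : Poly s), x⁆ = 0 := fun x => by
      rw [← lie_skew, lie_one, neg_zero]
    simp only [add_lie, lie_add, smul_lie, lie_smul, lie_one, h1, smul_zero, add_zero]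
    exact Submodule.mem_sup_left ((odd s).lie_mem ha hb)

end

end SpinSphere

namespace SpinSphere

open MvPolynomial

noncomputable section

/-! ### Complexification of spaces of real polynomials -/

/-! Both claims reduce to one fact (`oddTilde_le_of_notMem_polyOne`): a subalgebra `R` that contains
𝒫¹ and some element outside it contains 𝒪̃. Bracketing with the coordinates makes `R` an
so(3)-module, so after complexification it can be studied by weights of `{S₃, ·}`. With ξ = S₁ + iS₂
and η = S₁ - iS₂, every function on the sphere is a sum of terms ξⁿF(S₃) and ηⁿF(S₃), and `R`
contains the weight components of its elements (`le_iSup`). A component outside 𝒫¹, bracketed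
repeatedly with ξ or η, becomes a pure power of exponent m ≥ 2 (`exists_xi_pow_or_eta_pow_mem`).
Since `R` is real, both ξᵐ and ηᵐ are obtained. Their bracket is a multiple of S₃(s² - S₃²)ᵐ⁻¹. A
Legendre operator lowers the exponent until S₃³ appears (`zonal_X_mul_profile_pow_mem`), brackets
with S₃³ give all odd powers of S₃ (`zonal_X_pow_mem`), and rotations spread these to all odd
monomials (`monomial_mem`). Everything is done with polynomials modulo the equation of the sphere,
as preimages of subspaces of 𝒫. -/

/-- The inclusion of the real polynomials into the complex ones. -/
def toC : MvPolynomial (Fin 3) ℝ →+* MvPolynomial (Fin 3) ℂ := MvPolynomial.map Complex.ofRealHom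

theorem C_I_mul_C_I : (C Complex.I * C Complex.I : MvPolynomial (Fin 3) ℂ) = -1 := by
  rw [← C_mul, Complex.I_mul_I, C_neg, C_1]

theorem toC_smul (c : ℝ) (g : MvPolynomial (Fin 3) ℝ) : toC (c • g) = C (c : ℂ) * toC g := by
  simp [toC, smul_eq_C_mul]

theorem toC_add_I_mul_toC_injective {g g' h h' : MvPolynomial (Fin 3) ℝ}
    (e : toC g + C Complex.I * toC h = toC g' + C Complex.I * toC h') : g = g' ∧ h = h' := by
  have key : ∀ m, g.coeff m = g'.coeff m ∧ h.coeff m = h'.coeff m := by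
    intro m
    have := congrArg (fun p => p.coeff m) e
    simp only [toC, coeff_add, coeff_map, coeff_C_mul, Complex.ofRealHom_eq_coe] at this
    exact ⟨by simpa using congrArg Complex.re this, by simpa using congrArg Complex.im this⟩
  exact ⟨MvPolynomial.ext _ _ fun m => (key m).1, MvPolynomial.ext _ _ fun m => (key m).2⟩

theorem exists_eq_toC_add_I_mul_toC (f : MvPolynomial (Fin 3) ℂ) :
    ∃ g h, f = toC g + C Complex.I * toC h := by
  induction f using MvPolynomial.induction_on with
  | C a =>
    refine ⟨C a.re, C a.im, ?_⟩
    simp only [toC, map_C, ← C_mul, ← C_add]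
    rw [mul_comm]
    simp
  | add p q hp hq =>
    obtain ⟨g, h, rfl⟩ := hp
    obtain ⟨g', h', rfl⟩ := hq
    exact ⟨g + g', h + h', by simp only [map_add]; ring⟩
  | mul_X p i hp =>
    obtain ⟨g, h, rfl⟩ := hp
    refine ⟨g * X i, h * X i, ?_⟩
    simp only [map_mul]
    simp only [toC, map_X]
    ring

/-- The complexification of a space of real polynomials. -/
def complexify (U : Submodule ℝ (MvPolynomial (Fin 3) ℝ)) :
    Submodule ℂ (MvPolynomial (Fin 3) ℂ) where
  carrier := {f | ∃ g ∈ U, ∃ h ∈ U, f = toC g + C Complex.I * toC h}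
  zero_mem' := ⟨0, U.zero_mem, 0, U.zero_mem, by simp⟩
  add_mem' := by
    rintro _ _ ⟨g, hg, h, hh, rfl⟩ ⟨g', hg', h', hh', rfl⟩
    exact ⟨g + g', U.add_mem hg hg', h + h', U.add_mem hh hh', by simp only [map_add]; ring⟩
  smul_mem' := by
    rintro c _ ⟨g, hg, h, hh, rfl⟩
    refine ⟨c.re • g - c.im • h, U.sub_mem (U.smul_mem _ hg) (U.smul_mem _ hh),
      c.re • h + c.im • g, U.add_mem (U.smul_mem _ hh) (U.smul_mem _ hg), ?_⟩
    have hc : (C c : MvPolynomial (Fin 3) ℂ) = C (c.re : ℂ) + C (c.im : ℂ) * C Complex.I := by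
      rw [← C_mul, ← C_add, Complex.re_add_im]
    simp only [map_add, map_sub, toC_smul]
    simp only [smul_eq_C_mul, hc]
    linear_combination (C (c.im : ℂ) * toC h) * C_I_mul_C_I

theorem toC_mem_complexify {U : Submodule ℝ (MvPolynomial (Fin 3) ℝ)}
    {g : MvPolynomial (Fin 3) ℝ} : toC g ∈ complexify U ↔ g ∈ U := by
  constructor
  · rintro ⟨g', hg', h', -, e⟩
    have := toC_add_I_mul_toC_injective (g := g) (h := 0) (by simpa using e)
    exact this.1 ▸ hg'
  · exact fun hg => ⟨g, hg, 0, U.zero_mem, by simp⟩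

theorem mul_mem_complexify {U : Submodule ℝ (MvPolynomial (Fin 3) ℝ)}
    {q : MvPolynomial (Fin 3) ℝ} (hq : ∀ p, p * q ∈ U) (f : MvPolynomial (Fin 3) ℂ) :
    f * toC q ∈ complexify U := by
  obtain ⟨g, h, rfl⟩ := exists_eq_toC_add_I_mul_toC f
  exact ⟨g * q, hq g, h * q, hq h, by simp only [map_mul]; ring⟩

/-- Complex conjugation of the coefficients. -/
def conj : MvPolynomial (Fin 3) ℂ →+* MvPolynomial (Fin 3) ℂ := MvPolynomial.map (starRingEnd ℂ)

theorem conj_toC (g : MvPolynomial (Fin 3) ℝ) : conj (toC g) = toC g := by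
  simp only [conj, toC, MvPolynomial.map_map]
  rw [show (starRingEnd ℂ).comp Complex.ofRealHom = Complex.ofRealHom from
    RingHom.ext fun x => by simp]

/-- This is where reality enters: conjugation exchanges ξ and η, so a power of one in the
complexified space brings the same power of the other. -/
theorem conj_mem_complexify {U : Submodule ℝ (MvPolynomial (Fin 3) ℝ)}
    {f : MvPolynomial (Fin 3) ℂ} (hf : f ∈ complexify U) : conj f ∈ complexify U := by
  obtain ⟨g, hg, h, hh, rfl⟩ := hf
  refine ⟨g, hg, -h, U.neg_mem hh, ?_⟩
  rw [map_add, map_mul, conj_toC, conj_toC]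
  simp [conj]

/-! ### The bracket on complex polynomials -/

/-- The Hamiltonian derivation `{f, ·}` of `ℂ[S₁, S₂, S₃]`. -/
def ham (f : MvPolynomial (Fin 3) ℂ) :
    Derivation ℂ (MvPolynomial (Fin 3) ℂ) (MvPolynomial (Fin 3) ℂ) :=
  (X 1 * pderiv 2 f - X 2 * pderiv 1 f) • pderiv 0 +
    (X 2 * pderiv 0 f - X 0 * pderiv 2 f) • pderiv 1 +
    (X 0 * pderiv 1 f - X 1 * pderiv 0 f) • pderiv 2

theorem ham_apply (f g : MvPolynomial (Fin 3) ℂ) : ham f g =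
    X 0 * (pderiv 1 f * pderiv 2 g - pderiv 2 f * pderiv 1 g) +
    X 1 * (pderiv 2 f * pderiv 0 g - pderiv 0 f * pderiv 2 g) +
    X 2 * (pderiv 0 f * pderiv 1 g - pderiv 1 f * pderiv 0 g) := by
  simp only [ham, Derivation.add_apply, Derivation.smul_apply, smul_eq_mul]
  ring

theorem ham_antisymm (f g : MvPolynomial (Fin 3) ℂ) : ham f g = -ham g f := by
  rw [ham_apply, ham_apply]; ring

theorem ham_toC (f g : MvPolynomial (Fin 3) ℝ) : ham (toC f) (toC g) = toC (polyBracket f g) := by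
  simp only [ham_apply, toC, pderiv_map, polyBracket, map_add, map_mul, map_sub, map_X]

theorem ham_mem_complexify {U : Submodule ℝ (MvPolynomial (Fin 3) ℝ)}
    (hU : ∀ f ∈ U, ∀ g ∈ U, polyBracket f g ∈ U) {f g : MvPolynomial (Fin 3) ℂ}
    (hf : f ∈ complexify U) (hg : g ∈ complexify U) : ham f g ∈ complexify U := by
  obtain ⟨a, ha, b, hb, rfl⟩ := hf
  obtain ⟨c, hc, d, hd, rfl⟩ := hg
  refine ⟨polyBracket a c - polyBracket b d, U.sub_mem (hU _ ha _ hc) (hU _ hb _ hd),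
    polyBracket a d + polyBracket b c, U.add_mem (hU _ ha _ hd) (hU _ hb _ hc), ?_⟩
  simp only [map_add, map_sub, ← ham_toC]
  simp only [ham_apply, map_add, pderiv_C_mul]
  linear_combination ham (toC b) (toC d) * C_I_mul_C_I -
    (C Complex.I * C Complex.I + 1) * ham_apply (toC b) (toC d)

/-! ### Weight vectors -/

theorem mem_of_sum_eigenvectors_mem {V ι : Type*} [AddCommGroup V] [Module ℂ V]
    {W : Submodule ℂ V} {T : V →ₗ[ℂ] V} (hT : ∀ v ∈ W, T v ∈ W) {μ : ι → ℂ}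
    (hμ : Function.Injective μ) (s : Finset ι) (v : ι → V) (hv : ∀ i, T (v i) = μ i • v i)
    (h : ∑ i ∈ s, v i ∈ W) : ∀ i ∈ s, v i ∈ W := by
  classical
  induction s using Finset.induction_on generalizing v with
  | empty => simp
  | insert a s ha ih =>
    -- Applying `T - μ a` removes the `a`-th term and rescales the others by nonzero factors.
    have h1 : ∑ i ∈ s, (μ i - μ a) • v i ∈ W := by
      have := W.sub_mem (hT _ h) (W.smul_mem (μ a) h)
      rw [Finset.sum_insert ha, map_add, map_sum, smul_add, hv, Finset.smul_sum,
        add_sub_add_left_eq_sub, ← Finset.sum_sub_distrib] at this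
      simpa only [hv, sub_smul] using this
    have h2 : ∀ i ∈ s, v i ∈ W := by
      intro i hi
      have h3 := ih (fun i => (μ i - μ a) • v i)
        (fun i => by rw [map_smul, hv, smul_comm]) h1 i hi
      have hne : μ i - μ a ≠ 0 := sub_ne_zero.mpr fun e => ha (hμ e ▸ hi)
      exact (W.smul_mem_iff hne).mp h3
    intro i hi
    rcases Finset.mem_insert.mp hi with rfl | hi
    · rw [Finset.sum_insert ha] at h
      exact (W.add_mem_iff_left (W.sum_mem h2)).mp h
    · exact h2 i hi

/-- The raising coordinate `S₁ + i S₂`. -/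
def xi : MvPolynomial (Fin 3) ℂ := X 0 + C Complex.I * X 1

/-- The lowering coordinate `S₁ - i S₂`. -/
def eta : MvPolynomial (Fin 3) ℂ := X 0 - C Complex.I * X 1

theorem conj_xi : conj xi = eta := by
  simp [conj, xi, eta, sub_eq_add_neg]

theorem conj_eta : conj eta = xi := by
  simp [conj, xi, eta]

theorem ham_X2_xi : ham (X 2) xi = - C Complex.I * xi := by
  simp [ham_apply, xi, pderiv_X]
  linear_combination X 1 * C_I_mul_C_I

theorem ham_X2_eta : ham (X 2) eta = C Complex.I * eta := by
  simp [ham_apply, eta, pderiv_X]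
  linear_combination X 1 * C_I_mul_C_I

theorem ham_xi_xi : ham xi xi = 0 := by rw [ham_apply]; ring

theorem ham_eta_eta : ham eta eta = 0 := by rw [ham_apply]; ring

theorem ham_eta_xi : ham eta xi = 2 * C Complex.I * X 2 := by
  simp [ham_apply, xi, eta, pderiv_X]
  ring

theorem ham_xi_X2 : ham xi (X 2) = C Complex.I * xi := by
  rw [ham_antisymm, ham_X2_xi]; ring

theorem ham_eta_X2 : ham eta (X 2) = - C Complex.I * eta := by
  rw [ham_antisymm, ham_X2_eta]; ring

/-! ### Functions of S₃ and the weight decomposition on the sphere. -/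

/-- The polynomial `F(S₃)`. -/
def zonal : Polynomial ℂ →ₐ[ℂ] MvPolynomial (Fin 3) ℂ := Polynomial.aeval (X 2)

theorem zonal_X : zonal Polynomial.X = X 2 := by simp [zonal]

theorem zonal_C (a : ℂ) : zonal (Polynomial.C a) = C a := by
  simp [zonal, MvPolynomial.algebraMap_eq]

theorem ham_zonal (f : MvPolynomial (Fin 3) ℂ) (F : Polynomial ℂ) :
    ham f (zonal F) = zonal (Polynomial.derivative F) * ham f (X 2) := by
  rw [zonal, Derivation.map_aeval, smul_eq_mul]

/-- The complexified equation of the sphere. -/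
def sphere (s : ℝ) : MvPolynomial (Fin 3) ℂ := toC (X 0 ^ 2 + X 1 ^ 2 + X 2 ^ 2 - C (s ^ 2))

/-- The polynomial `s² - z²`. -/
def profile (s : ℝ) : Polynomial ℂ := Polynomial.C ((s : ℂ) ^ 2) - Polynomial.X ^ 2

theorem sphere_eq (s : ℝ) :
    sphere s = X 0 ^ 2 + X 1 ^ 2 + X 2 ^ 2 - C ((s : ℂ) ^ 2) := by
  simp [sphere, toC]

theorem zonal_profile (s : ℝ) : zonal (profile s) = C ((s : ℂ) ^ 2) - X 2 ^ 2 := by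
  rw [profile, map_sub, map_pow zonal, zonal_X, zonal_C]

theorem xi_mul_eta (s : ℝ) : xi * eta = sphere s + zonal (profile s) := by
  rw [zonal_profile, sphere_eq, xi, eta]
  linear_combination - X 1 ^ 2 * C_I_mul_C_I

/-- The weight vector `(S₁ + i S₂)ᵏ`, or `(S₁ - i S₂)⁻ᵏ` for negative `k`. -/
def weightVector : ℤ → MvPolynomial (Fin 3) ℂ
  | Int.ofNat n => xi ^ n
  | Int.negSucc n => eta ^ (n + 1)

/-- The multiples of the `k`-th weight vector by polynomials in `S₃`. -/
def weightSpace (k : ℤ) : Submodule ℂ (MvPolynomial (Fin 3) ℂ) :=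
  LinearMap.range (LinearMap.mulLeft ℂ (weightVector k) ∘ₗ
    zonal.toLinearMap)

theorem mem_weightSpace {k : ℤ} {f : MvPolynomial (Fin 3) ℂ} :
    f ∈ weightSpace k ↔ ∃ F : Polynomial ℂ, weightVector k * zonal F = f := by
  simp [weightSpace]

theorem ham_X2_xi_pow_mul_zonal (n : ℕ) (F : Polynomial ℂ) :
    ham (X 2) (xi ^ n * zonal F) = C (-Complex.I * n) * (xi ^ n * zonal F) := by
  have h : ham (X 2) (X 2) = 0 := by rw [ham_apply]; ring
  rw [Derivation.leibniz, Derivation.leibniz_pow, ham_zonal, h, ham_X2_xi]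
  cases n with
  | zero => simp
  | succ n =>
    simp only [smul_eq_mul, nsmul_eq_mul, Nat.add_sub_cancel, C_mul, C_neg, map_natCast]
    ring

theorem ham_X2_eta_pow_mul_zonal (n : ℕ) (F : Polynomial ℂ) :
    ham (X 2) (eta ^ n * zonal F) = C (Complex.I * n) * (eta ^ n * zonal F) := by
  have h : ham (X 2) (X 2) = 0 := by rw [ham_apply]; ring
  rw [Derivation.leibniz, Derivation.leibniz_pow, ham_zonal, h, ham_X2_eta]
  cases n with
  | zero => simp
  | succ n =>
    simp only [smul_eq_mul, nsmul_eq_mul, Nat.add_sub_cancel, C_mul, map_natCast]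
    ring

theorem ham_X2_of_mem_weightSpace {k : ℤ} {f : MvPolynomial (Fin 3) ℂ} (hf : f ∈ weightSpace k) :
    ham (X 2) f = (-Complex.I * k) • f := by
  obtain ⟨F, rfl⟩ := mem_weightSpace.mp hf
  rw [smul_eq_C_mul]
  cases k with
  | ofNat n => exact_mod_cast ham_X2_xi_pow_mul_zonal n F
  | negSucc n =>
    have := ham_X2_eta_pow_mul_zonal (n + 1) F
    rw [weightVector, this]
    congr 2
    push_cast [Int.cast_negSucc]
    ring

/-- The multiples of the equation of the sphere. -/
def sphereMultiples (s : ℝ) : Submodule ℂ (MvPolynomial (Fin 3) ℂ) :=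
  (Ideal.span {sphere s}).restrictScalars ℂ

theorem mem_sphereMultiples {s : ℝ} {f : MvPolynomial (Fin 3) ℂ} :
    f ∈ sphereMultiples s ↔ ∃ p, p * sphere s = f := by
  simp [sphereMultiples, Ideal.mem_span_singleton']

theorem X_zero_eq : X 0 = (2⁻¹ : ℂ) • (xi + eta) := by
  rw [eq_inv_smul_iff₀ two_ne_zero, xi, eta, two_smul]
  ring

theorem X_one_eq : X 1 = (2 * Complex.I)⁻¹ • (xi - eta) := by
  rw [eq_inv_smul_iff₀ (mul_ne_zero two_ne_zero Complex.I_ne_zero), xi, eta, mul_smul, two_smul,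
    smul_eq_C_mul]
  ring

/-- The left side contains the constants and is stable under multiplication by ξ, η and S₃, hence by
all coordinates. Mixed products stay inside because ξη equals s² - S₃² modulo the equation of the
sphere. -/
theorem iSup_weightSpace_sup_sphereMultiples (s : ℝ) :
    (⨆ k, weightSpace k) ⊔ sphereMultiples s = ⊤ := by
  set S := (⨆ k, weightSpace k) ⊔ sphereMultiples s with hS
  have hJ : ∀ p, p * sphere s ∈ S := fun p => Submodule.mem_sup_right
    (mem_sphereMultiples.mpr ⟨p, rfl⟩)
  have hE : ∀ k F, weightVector k * zonal F ∈ S := fun k F => Submodule.mem_sup_left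
    (Submodule.mem_iSup_of_mem k (mem_weightSpace.mpr ⟨F, rfl⟩))
  have hxi : ∀ n F, xi ^ n * zonal F ∈ S := fun n F => hE (Int.ofNat n) F
  have heta : ∀ n F, eta ^ n * zonal F ∈ S := by
    rintro (_ | n) F
    · simpa using hxi 0 F
    · exact hE (Int.negSucc n) F
  have hmul : ∀ g, (∀ n F, xi ^ n * zonal F * g ∈ S) → (∀ n F, eta ^ n * zonal F * g ∈ S) →
      ∀ f ∈ S, f * g ∈ S := by
    intro g h1 h2
    suffices h : S ≤ S.comap (LinearMap.mulRight ℂ g) from fun f hf => by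
      simpa only [Submodule.mem_comap, LinearMap.mulRight_apply] using h hf
    rw [hS]
    refine sup_le (iSup_le ?_) ?_ <;> rw [← hS]
    · intro k f hf
      obtain ⟨F, rfl⟩ := mem_weightSpace.mp hf
      rw [Submodule.mem_comap, LinearMap.mulRight_apply]
      cases k with
      | ofNat n => rw [weightVector]; exact h1 n F
      | negSucc n => rw [weightVector]; exact h2 (n + 1) F
    · intro f hf
      obtain ⟨p, rfl⟩ := mem_sphereMultiples.mp hf
      rw [Submodule.mem_comap, LinearMap.mulRight_apply]
      have := hJ (p * g)
      rwa [mul_right_comm] at this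
  have m1 : ∀ f ∈ S, f * xi ∈ S := by
    refine hmul xi (fun n F => ?_) (fun n F => ?_)
    · have := hxi (n + 1) F
      rwa [pow_succ, mul_right_comm] at this
    · cases n with
      | zero => simpa [mul_comm] using hxi 1 F
      | succ n =>
        have : eta ^ (n + 1) * zonal F * xi =
            (eta ^ n * zonal F) * sphere s + eta ^ n * zonal (profile s * F) := by
          rw [map_mul zonal]
          linear_combination eta ^ n * zonal F * xi_mul_eta s
        rw [this]
        exact S.add_mem (hJ _) (heta _ _)
  have m2 : ∀ f ∈ S, f * eta ∈ S := by
    refine hmul eta (fun n F => ?_) (fun n F => ?_)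
    · cases n with
      | zero => simpa [mul_comm] using heta 1 F
      | succ n =>
        have : xi ^ (n + 1) * zonal F * eta =
            (xi ^ n * zonal F) * sphere s + xi ^ n * zonal (profile s * F) := by
          rw [map_mul zonal]
          linear_combination xi ^ n * zonal F * xi_mul_eta s
        rw [this]
        exact S.add_mem (hJ _) (hxi _ _)
    · have := heta (n + 1) F
      rwa [pow_succ, mul_right_comm] at this
  have m3 : ∀ f ∈ S, f * X 2 ∈ S := by
    have hz : ∀ F, zonal F * X 2 = zonal (F * Polynomial.X) := fun F => by
      rw [map_mul, zonal_X]
    refine hmul (X 2) (fun n F => ?_) (fun n F => ?_)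
    · rw [mul_assoc, hz]; exact hxi _ _
    · rw [mul_assoc, hz]; exact heta _ _
  rw [eq_top_iff]
  intro f _
  induction f using MvPolynomial.induction_on with
  | C a => simpa [zonal_C] using hxi 0 (Polynomial.C a)
  | add p q hp hq => exact S.add_mem (hp trivial) (hq trivial)
  | mul_X p i hp =>
    have hp := hp trivial
    match i with
    | 0 =>
      rw [X_zero_eq, mul_smul_comm, mul_add]
      exact S.smul_mem _ (S.add_mem (m1 p hp) (m2 p hp))
    | 1 =>
      rw [X_one_eq, mul_smul_comm, mul_sub]
      exact S.smul_mem _ (S.sub_mem (m1 p hp) (m2 p hp))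
    | 2 => exact m3 p hp

/-- A space of complex polynomials that is the preimage of a Lie algebra of functions on the sphere
containing the coordinates. -/
structure IsSphereAlgebra (s : ℝ) (W : Submodule ℂ (MvPolynomial (Fin 3) ℂ)) : Prop where
  mul_sphere_mem : ∀ p, p * sphere s ∈ W
  X_mem : ∀ i, X i ∈ W
  ham_mem : ∀ f ∈ W, ∀ g ∈ W, ham f g ∈ W

/-! ### Weight components and extreme powers in a sphere algebra. -/

namespace IsSphereAlgebra

variable {s : ℝ} {W : Submodule ℂ (MvPolynomial (Fin 3) ℂ)}

theorem C_mul_mem_iff {a : ℂ} (ha : a ≠ 0) {f : MvPolynomial (Fin 3) ℂ} :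
    C a * f ∈ W ↔ f ∈ W := by
  rw [← smul_eq_C_mul, W.smul_mem_iff ha]

theorem mem_of_C_mul_eq {a : ℂ} (ha : a ≠ 0) {f g : MvPolynomial (Fin 3) ℂ} (h : g ∈ W)
    (e : g = C a * f) : f ∈ W :=
  (C_mul_mem_iff ha).mp (e ▸ h)

theorem xi_mem (hW : IsSphereAlgebra s W) : xi ∈ W := by
  rw [xi, ← smul_eq_C_mul]
  exact W.add_mem (hW.X_mem 0) (W.smul_mem _ (hW.X_mem 1))

theorem eta_mem (hW : IsSphereAlgebra s W) : eta ∈ W := by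
  rw [eta, ← smul_eq_C_mul]
  exact W.sub_mem (hW.X_mem 0) (W.smul_mem _ (hW.X_mem 1))

/-- Every element is a sum of weight vectors in the space, up to multiples of the equation. -/
theorem le_iSup (hW : IsSphereAlgebra s W) :
    W ≤ (⨆ k, weightSpace k ⊓ W) ⊔ sphereMultiples s := by
  intro f hf
  have hf' : f ∈ (⨆ k, weightSpace k) ⊔ sphereMultiples s := by
    rw [iSup_weightSpace_sup_sphereMultiples]; trivial
  obtain ⟨g, hg, j, hj, rfl⟩ := Submodule.mem_sup.mp hf'
  have hjW : j ∈ W := by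
    obtain ⟨p, rfl⟩ := mem_sphereMultiples.mp hj
    exact hW.mul_sphere_mem p
  obtain ⟨v, hv, rfl⟩ := (Submodule.mem_iSup_iff_exists_finsupp _ _).mp hg
  have hsum := (W.add_mem_iff_left hjW).mp hf
  have hμ : Function.Injective fun k : ℤ => -Complex.I * (k : ℂ) := by
    intro a b hab
    simpa using hab
  -- Distinct weights have distinct eigenvalues under `{S₃, ·}`, which preserves `W`.
  have key := mem_of_sum_eigenvectors_mem (T := (ham (X 2) : MvPolynomial (Fin 3) ℂ →ₗ[ℂ] _))
    (fun v hv => hW.ham_mem _ (hW.X_mem 2) v hv) hμ v.support v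
    (fun k => ham_X2_of_mem_weightSpace (hv k)) hsum
  refine Submodule.add_mem_sup (Submodule.sum_mem _ fun k hk => ?_) hj
  exact Submodule.mem_iSup_of_mem k ⟨hv k, key k hk⟩

theorem ham_xi_xi_pow_mul_zonal (n : ℕ) (F : Polynomial ℂ) :
    ham xi (xi ^ n * zonal F) = C Complex.I * (xi ^ (n + 1) * zonal (Polynomial.derivative F)) := by
  rw [Derivation.leibniz, Derivation.leibniz_pow, ham_zonal, ham_xi_xi, ham_xi_X2]
  simp only [smul_eq_mul]
  ring

theorem ham_eta_eta_pow_mul_zonal (n : ℕ) (F : Polynomial ℂ) :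
    ham eta (eta ^ n * zonal F) =
      C (-Complex.I) * (eta ^ (n + 1) * zonal (Polynomial.derivative F)) := by
  rw [Derivation.leibniz, Derivation.leibniz_pow, ham_zonal, ham_eta_eta, ham_eta_X2, C_neg]
  simp only [smul_eq_mul]
  ring

/-- Up to a factor, `{ξ, ·}` differentiates the factor in S₃ and adds one to the exponent of ξ.
After `d` brackets only a nonzero constant is left of `F`. -/
theorem xi_pow_mem (hW : IsSphereAlgebra s W) (d : ℕ) : ∀ (n : ℕ) (F : Polynomial ℂ),
    F.natDegree = d → F ≠ 0 → xi ^ n * zonal F ∈ W → xi ^ (n + d) ∈ W := by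
  induction d with
  | zero =>
    intro n F hd h0 h
    obtain ⟨a, rfl⟩ := Polynomial.natDegree_eq_zero.mp hd
    have ha : a ≠ 0 := by rintro rfl; simp at h0
    refine mem_of_C_mul_eq ha h ?_
    rw [zonal_C, mul_comm, add_zero]
  | succ d ih =>
    intro n F hd h0 h
    have h1 := hW.ham_mem _ hW.xi_mem _ h
    rw [ham_xi_xi_pow_mul_zonal, C_mul_mem_iff Complex.I_ne_zero] at h1
    have hd' : (Polynomial.derivative F).natDegree = d := by
      rw [Polynomial.natDegree_derivative, hd, Nat.add_sub_cancel]
    have h0' : Polynomial.derivative F ≠ 0 := by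
      intro h; rw [Polynomial.derivative_eq_zero] at h; omega
    have := ih (n + 1) _ hd' h0' h1
    rwa [add_right_comm] at this

theorem eta_pow_mem (hW : IsSphereAlgebra s W) (d : ℕ) : ∀ (n : ℕ) (F : Polynomial ℂ),
    F.natDegree = d → F ≠ 0 → eta ^ n * zonal F ∈ W → eta ^ (n + d) ∈ W := by
  induction d with
  | zero =>
    intro n F hd h0 h
    obtain ⟨a, rfl⟩ := Polynomial.natDegree_eq_zero.mp hd
    have ha : a ≠ 0 := by rintro rfl; simp at h0
    refine mem_of_C_mul_eq ha h ?_
    rw [zonal_C, mul_comm, add_zero]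
  | succ d ih =>
    intro n F hd h0 h
    have h1 := hW.ham_mem _ hW.eta_mem _ h
    rw [ham_eta_eta_pow_mul_zonal, C_mul_mem_iff (neg_ne_zero.mpr Complex.I_ne_zero)] at h1
    have hd' : (Polynomial.derivative F).natDegree = d := by
      rw [Polynomial.natDegree_derivative, hd, Nat.add_sub_cancel]
    have h0' : Polynomial.derivative F ≠ 0 := by
      intro h; rw [Polynomial.derivative_eq_zero] at h; omega
    have := ih (n + 1) _ hd' h0' h1
    rwa [add_right_comm] at this

/-! ### Zonal polynomials -/

/-- Zonal polynomials commute with each other, so a detour is taken through weight one: `{ξ, f}` is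
a multiple of ξf', its bracket with `h` a multiple of ξf'h', and `{η, ·}` returns to weight zero.
With Q = s² - z², the result is -(Q f' h')'; for h = z it is the Legendre operator applied to `f`.
-/
theorem zonal_lie_mem (hW : IsSphereAlgebra s W) {f h : Polynomial ℂ} (hf : zonal f ∈ W)
    (hh : zonal h ∈ W) :
    zonal (2 * Polynomial.X * (Polynomial.derivative f * Polynomial.derivative h) -
      profile s * Polynomial.derivative (Polynomial.derivative f * Polynomial.derivative h)) ∈ W := by
  set f' := Polynomial.derivative f
  set h' := Polynomial.derivative h
  have h1 : xi * zonal f' ∈ W := by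
    refine mem_of_C_mul_eq Complex.I_ne_zero (hW.ham_mem _ hW.xi_mem _ hf) ?_
    rw [ham_zonal, ham_xi_X2]
    ring
  have h2 : xi * zonal (f' * h') ∈ W := by
    refine mem_of_C_mul_eq Complex.I_ne_zero (hW.ham_mem _ h1 _ hh) ?_
    rw [ham_zonal, ham_antisymm, Derivation.leibniz, ham_zonal, ham_X2_xi, map_mul]
    have h : ham (X 2) (X 2) = 0 := by rw [ham_apply]; ring
    rw [h]
    simp only [smul_eq_mul]
    ring
  have h3 := hW.ham_mem _ hW.eta_mem _ h2
  rw [Derivation.leibniz, ham_zonal, ham_eta_xi, ham_eta_X2] at h3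
  -- The added multiple of the equation replaces ξη by s² - S₃².
  refine mem_of_C_mul_eq Complex.I_ne_zero (W.add_mem h3 (hW.mul_sphere_mem
    (C Complex.I * zonal (Polynomial.derivative (f' * h'))))) ?_
  simp only [smul_eq_mul, map_sub, map_mul zonal, zonal_X, map_ofNat]
  linear_combination (- C Complex.I * zonal (Polynomial.derivative (f' * h'))) * xi_mul_eta s

/-- With Q = s² - z², the Legendre operator sends zQᵏ⁺¹ to (2k+3)(2k+4) zQᵏ⁺¹ - 4(k+1)²s² zQᵏ.
Cancelling the first term leaves a multiple of zQᵏ, which is nonzero because s ≠ 0. -/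
theorem zonal_X_mul_profile_pow_mem (hW : IsSphereAlgebra s W) (hs : s ≠ 0) {k : ℕ}
    (h : zonal (Polynomial.X * profile s ^ (k + 1)) ∈ W) :
    zonal (Polynomial.X * profile s ^ k) ∈ W := by
  have hX : zonal Polynomial.X ∈ W := zonal_X ▸ hW.X_mem 2
  have h1 := hW.zonal_lie_mem h hX
  have hne : (4 * (k + 1) ^ 2 * s ^ 2 : ℂ) ≠ 0 := by
    have h1 : (s : ℂ) ≠ 0 := by exact_mod_cast hs
    have h2 : (k + 1 : ℂ) ≠ 0 := by exact_mod_cast k.succ_ne_zero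
    exact mul_ne_zero (mul_ne_zero (by norm_num) (pow_ne_zero 2 h2)) (pow_ne_zero 2 h1)
  refine mem_of_C_mul_eq hne (W.sub_mem (W.smul_mem ((2 * k + 3) * (2 * k + 4)) h) h1) ?_
  rw [← map_smul, ← map_sub, ← zonal_C, ← map_mul zonal]
  congr 1
  set Q := profile s with hQdef
  have hp : Polynomial.derivative Q = - 2 * Polynomial.X := by
    simp only [hQdef, profile, map_sub, Polynomial.derivative_C, Polynomial.derivative_X_pow]
    simp [← map_ofNat Polynomial.C 2]
  have hX2 : (Polynomial.X : Polynomial ℂ) ^ 2 = Polynomial.C ((s : ℂ) ^ 2) - Q := by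
    simp [hQdef, profile]
  have hQ : ∀ k : ℕ, Q * Polynomial.derivative (Q ^ k) =
      - (2 * (k : Polynomial ℂ) * Polynomial.X * Q ^ k) := by
    rintro (_ | k)
    · simp
    · rw [Polynomial.derivative_pow_succ, hp]
      simp only [map_add, map_natCast, map_one]
      push_cast
      ring
  have hd : Polynomial.derivative (Polynomial.X * Q ^ (k + 1)) =
      Polynomial.C (2 * k + 3 : ℂ) * Q ^ (k + 1) -
        Polynomial.C (2 * (k + 1) * (s : ℂ) ^ 2) * Q ^ k := by
    rw [Polynomial.derivative_mul, Polynomial.derivative_X, Polynomial.derivative_pow_succ, hp]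
    simp only [map_add, map_natCast, map_one, map_mul, map_ofNat]
    linear_combination (-2 * (k + 1 : Polynomial ℂ) * Q ^ k) * hX2
  rw [Polynomial.derivative_X, mul_one, hd, Polynomial.derivative_sub, Polynomial.derivative_C_mul,
    Polynomial.derivative_C_mul, Polynomial.smul_eq_C_mul]
  simp only [map_add, map_natCast, map_one, map_mul, map_ofNat, map_pow]
  have e1 := hQ (k + 1)
  push_cast at e1
  linear_combination (2 * k + 3 : Polynomial ℂ) * e1 -
    (2 * (k + 1) * Polynomial.C (s : ℂ) ^ 2 : Polynomial ℂ) * hQ k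

/-- Taking f = z³ and h = z²ᵏ⁺¹ in `zonal_lie_mem` gives a combination of z²ᵏ⁺³, with nonzero
coefficient, and z²ᵏ⁺¹. -/
theorem zonal_X_pow_mem (hW : IsSphereAlgebra s W) (h3 : zonal (Polynomial.X ^ 3) ∈ W) (k : ℕ) :
    zonal (Polynomial.X ^ (2 * k + 1)) ∈ W := by
  induction k with
  | zero => simpa [zonal_X] using hW.X_mem 2
  | succ k ih =>
    have h1 := hW.zonal_lie_mem h3 ih
    have hne : (3 * (2 * k + 1) * (2 * k + 4) : ℂ) ≠ 0 := by
      exact_mod_cast (by positivity : 3 * (2 * k + 1) * (2 * k + 4) ≠ 0)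
    refine mem_of_C_mul_eq hne (W.add_mem h1
      (W.smul_mem (3 * (2 * k + 1) * (2 * k + 2) * s ^ 2) ih)) ?_
    rw [← map_smul, ← map_add, ← zonal_C, ← map_mul zonal]
    congr 1
    rw [Polynomial.smul_eq_C_mul]
    simp only [Polynomial.derivative_X_pow, Polynomial.derivative_mul, Polynomial.derivative_natCast,
      map_add, map_natCast, map_one, map_mul, map_ofNat, map_pow, profile]
    simp only [Nat.add_sub_cancel, Nat.reduceSub, Nat.cast_add, Nat.cast_mul, Nat.cast_ofNat,
      Nat.cast_one]
    cases k with
    | zero => simp; ring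
    | succ k =>
      rw [show 2 * (k + 1) - 1 = 2 * k + 1 by omega]
      push_cast
      ring

/-! ### Generating all odd monomials -/

/-- The rotations `{S₁, ·}` and `{S₂, ·}` trade one factor S₃ for S₂ or S₁, up to sign. The other
term they produce has a smaller exponent sum in S₁, S₂, so induction on that sum applies; total
degree is preserved. -/
theorem monomial_mem (hW : IsSphereAlgebra s W)
    (h : ∀ k, Odd k → (X 2 : MvPolynomial (Fin 3) ℂ) ^ k ∈ W) (N : ℕ) :
    ∀ a b c : ℕ, a + b ≤ N → Odd (a + b + c) → X 0 ^ a * X 1 ^ b * X 2 ^ c ∈ W := by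
  induction N with
  | zero =>
    intro a b c hab ho
    obtain ⟨rfl, rfl⟩ : a = 0 ∧ b = 0 := by omega
    simpa using h c (by simpa using ho)
  | succ N ih =>
    have hne : ∀ c : ℕ, (c + 1 : ℂ) ≠ 0 := fun c => by exact_mod_cast c.succ_ne_zero
    have e10 : ham (X 1) (X 0) = - X 2 := by simp [ham_apply, pderiv_X]
    have e12 : ham (X 1) (X 2) = X 0 := by simp [ham_apply, pderiv_X]
    have e11 : ham (X 1) (X 1) = 0 := by simp [ham_apply, pderiv_X]
    have e01 : ham (X 0) (X 1) = X 2 := by simp [ham_apply, pderiv_X]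
    have e02 : ham (X 0) (X 2) = - X 1 := by simp [ham_apply, pderiv_X]
    rintro a b c hab ho
    rw [Nat.odd_iff] at ho
    rcases a with _ | a
    · rcases b with _ | b
      · simpa using h c (by rw [Nat.odd_iff]; omega)
      · have h1 := hW.ham_mem _ (hW.X_mem 0) _
          (ih 0 b (c + 1) (by omega) (by rw [Nat.odd_iff]; omega))
        -- For `b = 0` the truncated exponent `b - 1` is harmless, since the coefficient vanishes.
        have h2 : C (b : ℂ) * (X 0 ^ 0 * X 1 ^ (b - 1) * X 2 ^ (c + 2)) ∈ W := by
          rcases b with _ | b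
          · simp
          · rw [← smul_eq_C_mul]
            exact W.smul_mem _ (ih 0 b (c + 2) (by omega) (by rw [Nat.odd_iff]; omega))
        refine mem_of_C_mul_eq (hne c) (W.sub_mem h2 h1) ?_
        simp only [Derivation.leibniz, Derivation.leibniz_pow, e01, e02, pow_zero, one_mul,
          Nat.add_sub_cancel, smul_eq_mul, nsmul_eq_mul, C_add, C_1, map_natCast]
        push_cast
        ring
    · have h1 := hW.ham_mem _ (hW.X_mem 1) _
        (ih a b (c + 1) (by omega) (by rw [Nat.odd_iff]; omega))
      have h2 : C (a : ℂ) * (X 0 ^ (a - 1) * X 1 ^ b * X 2 ^ (c + 2)) ∈ W := by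
        rcases a with _ | a
        · simp
        · rw [← smul_eq_C_mul]
          exact W.smul_mem _ (ih a b (c + 2) (by omega) (by rw [Nat.odd_iff]; omega))
      refine mem_of_C_mul_eq (hne c) (W.add_mem h1 h2) ?_
      simp only [Derivation.leibniz, Derivation.leibniz_pow, e10, e11, e12,
        Nat.add_sub_cancel, smul_eq_mul, nsmul_eq_mul, C_add, C_1, map_natCast]
      push_cast
      ring

/-! ### From one element outside 𝒫¹ to all odd monomials. -/

/-- `L` stands for the preimage of 𝒫¹. Some weight component ξⁿF(S₃) or ηⁿF(S₃) in `W` escapes `L`;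
if n + deg F were at most 1, it would be a combination of 1 and the coordinates. -/
theorem exists_xi_pow_or_eta_pow_mem (hW : IsSphereAlgebra s W)
    {L : Submodule ℂ (MvPolynomial (Fin 3) ℂ)} (hL1 : 1 ∈ L) (hLX : ∀ i, X i ∈ L)
    (hLs : ∀ p, p * sphere s ∈ L) (hWL : ¬ W ≤ L) :
    ∃ m, 2 ≤ m ∧ (xi ^ m ∈ W ∨ eta ^ m ∈ W) := by
  have h1 : ∃ k, ¬ weightSpace k ⊓ W ≤ L := by
    by_contra! h
    refine hWL (hW.le_iSup.trans (sup_le (iSup_le h) ?_))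
    intro f hf
    obtain ⟨p, rfl⟩ := mem_sphereMultiples.mp hf
    exact hLs p
  obtain ⟨k, hk⟩ := h1
  obtain ⟨f, ⟨hfk, hfW⟩, hfL⟩ := SetLike.not_le_iff_exists.mp hk
  obtain ⟨F, rfl⟩ := mem_weightSpace.mp hfk
  have hF0 : F ≠ 0 := by
    rintro rfl
    exact hfL (by simp)
  have hCL : ∀ a : ℂ, ∀ f ∈ L, f * C a ∈ L := fun a f hf => by
    rw [mul_comm, ← smul_eq_C_mul]
    exact L.smul_mem a hf
  have hxi : xi ∈ L := by
    rw [xi, mul_comm]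
    exact L.add_mem (hLX 0) (hCL _ _ (hLX 1))
  have heta : eta ∈ L := by
    rw [eta, mul_comm]
    exact L.sub_mem (hLX 0) (hCL _ _ (hLX 1))
  cases k with
  | ofNat n =>
    rw [weightVector] at hfW hfL
    refine ⟨n + F.natDegree, ?_, Or.inl (hW.xi_pow_mem _ _ F rfl hF0 hfW)⟩
    by_contra! hlt
    apply hfL
    rcases n with _ | n
    · obtain ⟨a, b, rfl⟩ := Polynomial.exists_eq_X_add_C_of_natDegree_le_one
        (show F.natDegree ≤ 1 by omega)
      rw [pow_zero, one_mul, map_add, map_mul zonal, zonal_C, zonal_C, zonal_X, mul_comm,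
        ← one_mul (C b)]
      exact L.add_mem (hCL _ _ (hLX 2)) (hCL _ _ hL1)
    · obtain ⟨a, rfl⟩ := Polynomial.natDegree_eq_zero.mp (show F.natDegree = 0 by omega)
      obtain rfl : n = 0 := by omega
      rw [zero_add, pow_one, zonal_C]
      exact hCL _ _ hxi
  | negSucc n =>
    rw [weightVector] at hfW hfL
    refine ⟨n + 1 + F.natDegree, ?_, Or.inr (hW.eta_pow_mem _ _ F rfl hF0 hfW)⟩
    by_contra! hlt
    apply hfL
    obtain ⟨a, rfl⟩ := Polynomial.natDegree_eq_zero.mp (show F.natDegree = 0 by omega)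
    obtain rfl : n = 0 := by omega
    rw [zero_add, pow_one, zonal_C]
    exact hCL _ _ heta

theorem zonal_X_mul_profile_pow_mem_of_pow_mem (hW : IsSphereAlgebra s W) {m : ℕ}
    (hxi : xi ^ (m + 1) ∈ W) (heta : eta ^ (m + 1) ∈ W) :
    zonal (Polynomial.X * profile s ^ m) ∈ W := by
  have h1 := hW.ham_mem _ heta _ hxi
  have e1 : ham (eta ^ (m + 1)) (xi ^ (m + 1)) =
      C (2 * Complex.I * (m + 1) ^ 2) * (X 2 * (xi * eta) ^ m) := by
    rw [Derivation.leibniz_pow, ham_antisymm, Derivation.leibniz_pow, ham_antisymm, ham_eta_xi]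
    simp only [Nat.add_sub_cancel, smul_eq_mul, nsmul_eq_mul, C_mul, C_add, C_1, map_natCast,
      map_ofNat, map_pow C]
    push_cast
    ring
  have hne : (2 * Complex.I * (m + 1) ^ 2 : ℂ) ≠ 0 :=
    mul_ne_zero (mul_ne_zero two_ne_zero Complex.I_ne_zero)
      (pow_ne_zero 2 (by exact_mod_cast m.succ_ne_zero))
  rw [e1, C_mul_mem_iff hne] at h1
  -- Since a - b divides aᵐ - bᵐ, the factor (ξη)ᵐ may be replaced by (s² - S₃²)ᵐ modulo the
  -- equation of the sphere.
  obtain ⟨p, hp⟩ := sub_dvd_pow_sub_pow (xi * eta) (zonal (profile s)) m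
  have hs : xi * eta - zonal (profile s) = sphere s := by rw [xi_mul_eta s]; ring
  have e2 : zonal (Polynomial.X * profile s ^ m) =
      X 2 * (xi * eta) ^ m - (X 2 * p) * sphere s := by
    rw [map_mul, map_pow, zonal_X]
    rw [hs] at hp
    linear_combination - X 2 * hp
  rw [e2]
  exact W.sub_mem h1 (hW.mul_sphere_mem _)

theorem odd_monomial_mem (hW : IsSphereAlgebra s W) (hs : s ≠ 0) {m : ℕ}
    (hxi : xi ^ (m + 2) ∈ W) (heta : eta ^ (m + 2) ∈ W) {a b c : ℕ} (ho : Odd (a + b + c)) :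
    X 0 ^ a * X 1 ^ b * X 2 ^ c ∈ W := by
  have h1 : ∀ k, zonal (Polynomial.X * profile s ^ (k + 1)) ∈ W →
      zonal (Polynomial.X * profile s ^ 1) ∈ W := by
    intro k
    induction k with
    | zero => exact id
    | succ k ih => exact fun h => ih (hW.zonal_X_mul_profile_pow_mem hs h)
  -- The exponent m + 2 ≥ 2 ensures that the descent starts at exponent m + 1 ≥ 1, so it can stop at
  -- S₃(s² - S₃²), which yields S₃³.
  have h2 := h1 m (hW.zonal_X_mul_profile_pow_mem_of_pow_mem hxi heta)
  have h3 : zonal (Polynomial.X ^ 3) ∈ W := by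
    have e : zonal (Polynomial.X ^ 3) =
        ((s : ℂ) ^ 2) • X 2 - zonal (Polynomial.X * profile s ^ 1) := by
      rw [pow_one, map_mul, zonal_profile, map_pow, zonal_X, smul_eq_C_mul]
      ring
    rw [e]
    exact W.sub_mem (W.smul_mem _ (hW.X_mem 2)) h2
  refine hW.monomial_mem (fun k hk => ?_) _ a b c le_rfl ho
  obtain ⟨j, rfl⟩ := hk
  have := hW.zonal_X_pow_mem h3 j
  rwa [map_pow, zonal_X] at this

end IsSphereAlgebra

/-! ### Polynomials of degree at most one -/

theorem one_mem_polyOne (s : ℝ) : (1 : Poly s) ∈ polyOne s :=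
  ⟨1, (mem_restrictTotalDegree _ _ _).mpr (by simp), map_one (mk s)⟩

theorem mk_X_mem_polyOne (s : ℝ) (i : Fin 3) : mk s (X i) ∈ polyOne s :=
  ⟨X i, (mem_restrictTotalDegree _ _ _).mpr (by simp), rfl⟩

theorem exists_eq_affine {f : MvPolynomial (Fin 3) ℝ} (hf : f ∈ restrictTotalDegree (Fin 3) ℝ 1) :
    ∃ (a : ℝ) (b : Fin 3 → ℝ), f = C a + ∑ i, C (b i) * X i := by
  rw [restrictTotalDegree, restrictSupport_eq_span] at hf
  induction hf using Submodule.span_induction with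
  | mem x hx =>
    obtain ⟨m, hm, rfl⟩ := hx
    rcases Nat.le_one_iff_eq_zero_or_eq_one.mp (show m.degree ≤ 1 from hm) with h | h
    · obtain rfl := (Finsupp.degree_eq_zero_iff m).mp h
      exact ⟨1, 0, by simp⟩
    · obtain ⟨i, rfl⟩ := (Finsupp.sum_eq_one_iff m).mp h
      refine ⟨0, Pi.single i 1, ?_⟩
      rw [Finset.sum_eq_single i (by intro j _ hj; simp [hj]) (by simp)]
      simp [X]
  | zero => exact ⟨0, 0, by simp⟩
  | add x y _ _ hx hy =>
    obtain ⟨a, b, rfl⟩ := hx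
    obtain ⟨a', b', rfl⟩ := hy
    refine ⟨a + a', b + b', ?_⟩
    simp only [Pi.add_apply, C_add, add_mul, Finset.sum_add_distrib]
    ring
  | smul c x _ hx =>
    obtain ⟨a, b, rfl⟩ := hx
    refine ⟨c * a, c • b, ?_⟩
    simp only [Pi.smul_apply, smul_eq_mul, C_mul, smul_eq_C_mul, mul_add, Finset.mul_sum, mul_assoc]

theorem mk_monomial_mem_odd (s : ℝ) {m : Fin 3 →₀ ℕ} (hm : Odd m.degree) (c : ℝ) :
    mk s (monomial m c) ∈ odd s :=
  ⟨monomial m c, (monomial_mem_restrictSupport ℝ).mpr (Or.inl hm), rfl⟩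

theorem odd_le_oddTilde (s : ℝ) : odd s ≤ oddTilde s :=
  fun _ hp => Submodule.mem_sup_left (S := (odd s).toSubmodule) hp

theorem one_mem_oddTilde (s : ℝ) : (1 : Poly s) ∈ oddTilde s :=
  Submodule.mem_sup_right (S := (odd s).toSubmodule) (Submodule.mem_span_singleton_self 1)

theorem polyOne_le_oddTilde (s : ℝ) : polyOne s ≤ oddTilde s := by
  rintro _ ⟨f, hf, rfl⟩
  obtain ⟨a, b, rfl⟩ := exists_eq_affine hf
  simp only [AlgHom.toLinearMap_apply, map_add, map_sum]
  refine add_mem ?_ (sum_mem fun i _ => ?_)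
  · have : mk s (C a) = a • (1 : Poly s) := by
      rw [← map_one (mk s), ← map_smul, smul_eq_C_mul, mul_one]
    rw [this]
    exact (oddTilde s).smul_mem a (one_mem_oddTilde s)
  · refine odd_le_oddTilde s ?_
    rw [C_mul_X_eq_monomial]
    exact mk_monomial_mem_odd s (by simp) _

theorem eval_eq_of_mk_eq {s : ℝ} {f g : MvPolynomial (Fin 3) ℝ} (h : mk s f = mk s g)
    {v : Fin 3 → ℝ} (hv : v 0 ^ 2 + v 1 ^ 2 + v 2 ^ 2 = s ^ 2) : eval v f = eval v g := by
  obtain ⟨a, ha⟩ := Ideal.mem_span_singleton'.mp (mk_eq_mk_iff.mp h)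
  rw [← sub_eq_zero, ← map_sub, ← ha]
  simp [hv]

theorem mk_X_mul_X_mul_X_notMem_polyOne {s : ℝ} (hs : s ≠ 0) :
    mk s (X 0 * X 1 * X 2) ∉ polyOne s := by
  rintro ⟨f, hf, h⟩
  obtain ⟨a, b, rfl⟩ := exists_eq_affine hf
  have key : ∀ x y z : ℝ, x ^ 2 + y ^ 2 + z ^ 2 = s ^ 2 →
      a + (b 0 * x + b 1 * y + b 2 * z) = x * y * z := by
    intro x y z hv
    simpa [Fin.sum_univ_three] using eval_eq_of_mk_eq h (v := ![x, y, z]) (by simpa using hv)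
  -- The points on the axes force all coefficients to vanish, while at (s/3, 2s/3, 2s/3) the cubic
  -- takes the value 4s³/27.
  have h0 := key s 0 0 (by ring)
  have h0' := key (-s) 0 0 (by ring)
  have h1 := key 0 s 0 (by ring)
  have h2 := key 0 0 s (by ring)
  have h3 := key (s / 3) (2 * s / 3) (2 * s / 3) (by ring)
  apply pow_ne_zero 3 hs
  linarith

theorem polyOne_lt_oddTilde {s : ℝ} (hs : s ≠ 0) : polyOne s < oddTilde s := by
  refine lt_of_le_not_ge (polyOne_le_oddTilde s) fun h => mk_X_mul_X_mul_X_notMem_polyOne hs ?_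
  apply h
  apply odd_le_oddTilde
  have : (X 0 * X 1 * X 2 : MvPolynomial (Fin 3) ℝ) = monomial
      (Finsupp.single 0 1 + Finsupp.single 1 1 + Finsupp.single 2 1) 1 := by
    simp [X, monomial_mul]
  rw [this]
  exact mk_monomial_mem_odd s (by simp only [map_add, Finsupp.degree_single]; decide) _

/-! ### Lie subalgebras containing the polynomials of degree at most one -/

/-- The complex polynomials whose real and imaginary parts represent elements of `R`. -/
def complexPreimage {s : ℝ} (R : LieSubalgebra ℝ (Poly s)) :
    Submodule ℂ (MvPolynomial (Fin 3) ℂ) :=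
  complexify (R.toSubmodule.comap (mk s).toLinearMap)

theorem toC_mem_complexPreimage {s : ℝ} {R : LieSubalgebra ℝ (Poly s)}
    {f : MvPolynomial (Fin 3) ℝ} : toC f ∈ complexPreimage R ↔ mk s f ∈ R :=
  toC_mem_complexify

theorem isSphereAlgebra_complexPreimage {s : ℝ} {R : LieSubalgebra ℝ (Poly s)}
    (hR : polyOne s ≤ R) : IsSphereAlgebra s (complexPreimage R) where
  mul_sphere_mem := by
    refine mul_mem_complexify fun p => ?_
    have : mk s (p * (X 0 ^ 2 + X 1 ^ 2 + X 2 ^ 2 - C (s ^ 2))) = 0 := by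
      rw [← map_zero (mk s), mk_eq_mk_iff, sub_zero]
      exact Ideal.mul_mem_left _ _ (Ideal.subset_span rfl)
    rw [Submodule.mem_comap, AlgHom.toLinearMap_apply, this]
    exact zero_mem _
  X_mem i := by
    have := toC_mem_complexPreimage.mpr (hR (mk_X_mem_polyOne s i))
    rwa [toC, map_X] at this
  ham_mem f hf g hg := ham_mem_complexify (fun _ hf _ hg => R.lie_mem hf hg) hf hg

theorem oddTilde_le_of_notMem_polyOne {s : ℝ} (hs : s ≠ 0) {R : LieSubalgebra ℝ (Poly s)}
    (hR : polyOne s ≤ R) {r : Poly s} (hr : r ∈ R) (hr1 : r ∉ polyOne s) : oddTilde s ≤ R := by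
  obtain ⟨f, rfl⟩ := mk_surjective s r
  have hW := isSphereAlgebra_complexPreimage hR
  have hL := isSphereAlgebra_complexPreimage (le_refl (polyOne s))
  have h1 : (1 : MvPolynomial (Fin 3) ℂ) ∈ complexPreimage (polyOne s) := by
    rw [← map_one toC, toC_mem_complexPreimage, map_one]
    exact one_mem_polyOne s
  obtain ⟨m, hm, h⟩ := hW.exists_xi_pow_or_eta_pow_mem h1 hL.X_mem hL.mul_sphere_mem
    fun hle => hr1 (toC_mem_complexPreimage.mp (hle (toC_mem_complexPreimage.mpr hr)))
  obtain ⟨m, rfl⟩ := Nat.exists_eq_add_of_le' hm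
  -- Whichever power is known, conjugation supplies the other.
  have hpow : xi ^ (m + 2) ∈ complexPreimage R ∧ eta ^ (m + 2) ∈ complexPreimage R := by
    rcases h with h | h
    · have := conj_mem_complexify h
      rw [map_pow, conj_xi] at this
      exact ⟨h, this⟩
    · have := conj_mem_complexify h
      rw [map_pow, conj_eta] at this
      exact ⟨this, h⟩
  have hodd : odd s ≤ R := by
    rintro _ ⟨g, hg, rfl⟩
    change g ∈ R.toSubmodule.comap (mk s).toLinearMap
    rw [SetLike.mem_coe, restrictSupport_eq_span] at hg
    refine Submodule.span_le.mpr ?_ hg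
    rintro _ ⟨n, hn, rfl⟩
    have hn' : Odd (n 0 + n 1 + n 2) := by
      have : Odd n.degree := hn
      rwa [Finsupp.degree_eq_sum, Fin.sum_univ_three] at this
    have e : toC (monomial n 1) = X 0 ^ n 0 * X 1 ^ n 1 * X 2 ^ n 2 := by
      rw [toC, map_monomial, monomial_eq, Finsupp.prod_fintype _ _ (by simp), Fin.prod_univ_three]
      simp
    have := hW.odd_monomial_mem hs hpow.1 hpow.2 hn'
    rw [← e] at this
    exact toC_mem_complexPreimage.mp this
  change (odd s).toSubmodule ⊔ Submodule.span ℝ {1} ≤ R.toSubmodule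
  refine sup_le hodd ?_
  rw [Submodule.span_singleton_le_iff_mem]
  exact hR (one_mem_polyOne s)

end

end SpinSphere

theorem proposition3 (s : ℝ) (hs : 0 < s) :
    (SpinSphere.polyOne s < SpinSphere.oddTilde s ∧
      ∀ R : LieSubalgebra ℝ (SpinSphere.Poly s),
        SpinSphere.polyOne s ≤ R → R ≤ SpinSphere.oddTilde s →
          R = SpinSphere.polyOne s ∨ R = SpinSphere.oddTilde s) ∧
    (∀ r ∈ SpinSphere.odd s, 1 < SpinSphere.degree r →
      LieSubalgebra.lieSpan ℝ (SpinSphere.Poly s)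
        ((SpinSphere.polyOne s : Set (SpinSphere.Poly s)) ∪ {r}) = SpinSphere.oddTilde s) := by
  refine ⟨⟨SpinSphere.polyOne_lt_oddTilde hs.ne', fun R h1 h2 => ?_⟩, fun r hr hdeg => ?_⟩
  · by_cases h : R ≤ SpinSphere.polyOne s
    · exact Or.inl (le_antisymm h h1)
    · obtain ⟨r, hr, hr1⟩ := SetLike.not_le_iff_exists.mp h
      exact Or.inr (le_antisymm h2 (SpinSphere.oddTilde_le_of_notMem_polyOne hs.ne' h1 hr hr1))
  · refine le_antisymm ?_ ?_
    · rw [LieSubalgebra.lieSpan_le]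
      rintro p (hp | rfl)
      · exact SpinSphere.polyOne_le_oddTilde s hp
      · exact SpinSphere.odd_le_oddTilde s hr
    · refine SpinSphere.oddTilde_le_of_notMem_polyOne hs.ne' (r := r)
        (fun p hp => LieSubalgebra.subset_lieSpan (Or.inl hp))
        (LieSubalgebra.subset_lieSpan (Or.inr rfl)) fun h => ?_
      have : SpinSphere.degree r ≤ 1 := SpinSphere.mem_polyLE_iff.mp h
      omega
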